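/- Regard the square lattice $\mathbb{Z}^2$ as the graph in which $u,v\in\mathbb{Z}^2$ are adjacent iff $u-v\in\{\pm(1,0),\pm(0,1)\}$, with edge set $E(\mathbb{Z}^2)$. An edge percolation measure on $\mathbb{Z}^2$ is a probability measure $\mu$ on $\{0,1\}^{E(\mathbb{Z}^2)}$ with the product $\sigma$-algebra; it is translation-invariant if it is invariant under the natural action of $\mathbb{Z}^2$ by translations. An edge $e$ is open in a configuration $\omega$ if $\omega_e=1$ and closed if $\omega_e=0$; the clusters of $\omega$ are the connected components of the graph formed by all vertices and the open edges. The dual $\omega^*$ of $\omega$ is a configuration on the planar dual lattice, whose vertices are the plaquettes (unit-square faces) of $\mathbb{Z}^2$, two plaquettes being adjacent iff they share a side: the dual edge joining two adjacent plaquettes is open in $\omega^*$ iff their common side is closed in $\omega$. Identifying the plaquette centered at $(x+1/2,y+1/2)$ with the vertex $(x,y)$ identifies the dual lattice with $\mathbb{Z}^2$, and $\mu^*$ denotes the law of $\omega^*$ when $\omega$ has law $\mu$. For an edge percolation measure $\nu$, let $\nu_{\mathrm{hp}}$ denote its marginal on the edges of $\mathbb{Z}^2$ with both endpoints in the upper half-plane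 $\mathbb{Z}\times\mathbb{Z}_{\ge 0}$, regarded as a percolation measure on that half-plane graph; write $\mu^*_{\mathrm{hp}}=(\mu^*)_{\mathrm{hp}}$. **Proposition.** Let $\mu$ be a translation-invariant edge percolation measure on $\mathbb{Z}^2$ such that $\mu_{\mathrm{hp}}$ almost surely has a unique infinite cluster (that is, exactly one). Then almost surely $\mu^*_{\mathrm{hp}}$ has no infinite cluster. -/

import Mathlib

open MeasureTheory

namespace Percolation

/-- The square lattice: the Cayley graph of `ℤ²` with generators `(1,0)` and `(0,1)`. -/
def squareLattice : SimpleGraph (ℤ × ℤ) :=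
  SimpleGraph.addCayley {((1 : ℤ), (0 : ℤ)), ((0 : ℤ), (1 : ℤ))}

theorem squareLattice_adj (u v : ℤ × ℤ) :
    squareLattice.Adj u v ↔
      (v.1 = u.1 + 1 ∧ v.2 = u.2) ∨ (v.1 = u.1 ∧ v.2 = u.2 + 1) ∨
      (u.1 = v.1 + 1 ∧ u.2 = v.2) ∨ (u.1 = v.1 ∧ u.2 = v.2 + 1) := by
  obtain ⟨a, b⟩ := u
  obtain ⟨c, d⟩ := v
  simp only [squareLattice, SimpleGraph.addCayley_adj, Set.mem_insert_iff, Set.mem_singleton_iff,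
    Prod.mk_add_mk, Prod.neg_mk, Prod.mk.injEq, ne_eq]
  omega

/-- The upper half-plane `ℤ × ℤ_{≥ 0}`, as an induced subgraph of the square lattice. -/
def halfPlane : SimpleGraph {p : ℤ × ℤ // 0 ≤ p.2} :=
  squareLattice.comap Subtype.val

/-- A percolation configuration on the edges of a graph `G`: an edge is open if its value is `true`
and closed if it is `false`.  This type carries the product `σ`-algebra. -/
abbrev Config {V : Type} (G : SimpleGraph V) : Type := G.edgeSet → Bool

/-- The subgraph, on all vertices of `G`, formed by the open edges. -/
def openGraph {V : Type} {G : SimpleGraph V} (ω : Config G) : SimpleGraph V :=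
  SimpleGraph.fromEdgeSet {e | ∃ h : e ∈ G.edgeSet, ω ⟨e, h⟩ = true}

/-- The clusters of `ω`, i.e. the connected components of the subgraph of open edges. -/
abbrev Cluster {V : Type} {G : SimpleGraph V} (ω : Config G) : Type :=
  (openGraph ω).ConnectedComponent

/-- There is exactly one infinite cluster. -/
def HasUniqueInfiniteCluster {V : Type} {G : SimpleGraph V} (ω : Config G) : Prop :=
  ∃! C : Cluster ω, C.supp.Infinite

/-- There is no infinite cluster. -/
def HasNoInfiniteCluster {V : Type} {G : SimpleGraph V} (ω : Config G) : Prop :=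
  ¬ ∃ C : Cluster ω, C.supp.Infinite

/-- Translation by `v`, as an automorphism of the square lattice. -/
def translation (v : ℤ × ℤ) : squareLattice ≃g squareLattice where
  toEquiv := Equiv.addLeft v
  map_rel_iff' := by
    intro a b
    simp only [squareLattice_adj, Equiv.coe_addLeft, Prod.fst_add, Prod.snd_add]
    omega

/-- The translation action of `ℤ²` on configurations: `e` is open in the translate of `ω` by `v`
exactly if the edge `e - v` is open in `ω`. -/
def translate (v : ℤ × ℤ) (ω : Config squareLattice) : Config squareLattice :=
  fun e => ω ((translation v).mapEdgeSet.symm e)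

/-- Invariance of an edge percolation measure under all translations by vectors of `ℤ²`. -/
def TranslationInvariant (μ : Measure (Config squareLattice)) : Prop :=
  ∀ v : ℤ × ℤ, μ.map (translate v) = μ

/-- Restriction of a configuration to the edges with both endpoints in the upper half-plane. -/
def restrictHalfPlane (ω : Config squareLattice) : Config halfPlane :=
  fun e => ω ((SimpleGraph.Hom.comap Subtype.val squareLattice).mapEdgeSet e)

/-- The marginal of an edge percolation measure on the upper half-plane. -/
noncomputable def halfPlaneMarginal (μ : Measure (Config squareLattice)) :
    Measure (Config halfPlane) :=
  μ.map restrictHalfPlane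

/-- The four corners of the plaquette (face) of the square lattice centred at
`(x + 1/2, y + 1/2)`.  This plaquette is labelled by its lower left corner `(x, y)`. -/
def corners (p : ℤ × ℤ) : Set (ℤ × ℤ) :=
  {(p.1, p.2), (p.1 + 1, p.2), (p.1, p.2 + 1), (p.1 + 1, p.2 + 1)}

/-- For adjacent plaquettes `p` and `q`, the pair of endpoints of the side which they share; here
`⊔` and `⊓` are the coordinatewise maximum and minimum (see `mem_crossedPair_iff`). -/
def crossedPair : Sym2 (ℤ × ℤ) → Sym2 (ℤ × ℤ) :=
  Sym2.lift ⟨fun p q => s(p ⊔ q, p ⊓ q + (1, 1)), fun p q => by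
    simp only [sup_comm p q, inf_comm p q]⟩

/-- The vertices in `crossedPair s(p, q)` are the common corners of the plaquettes `p` and `q`. -/
theorem mem_crossedPair_iff {p q : ℤ × ℤ} (h : squareLattice.Adj p q) (v : ℤ × ℤ) :
    v ∈ crossedPair s(p, q) ↔ v ∈ corners p ∧ v ∈ corners q := by
  rw [squareLattice_adj] at h
  obtain ⟨a, b⟩ := p
  obtain ⟨c, d⟩ := q
  obtain ⟨x, y⟩ := v
  simp only [crossedPair, corners, Sym2.lift_mk, Sym2.mem_iff, Prod.mk_sup_mk, Prod.mk_inf_mk,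
    Prod.mk_add_mk, Prod.mk.injEq, Set.mem_insert_iff, Set.mem_singleton_iff] at h ⊢
  omega

theorem crossedPair_mem_edgeSet (e : Sym2 (ℤ × ℤ)) (he : e ∈ squareLattice.edgeSet) :
    crossedPair e ∈ squareLattice.edgeSet := by
  induction e using Sym2.ind with
  | _ p q =>
    obtain ⟨a, b⟩ := p
    obtain ⟨c, d⟩ := q
    simp only [crossedPair, Sym2.lift_mk, SimpleGraph.mem_edgeSet, squareLattice_adj,
      Prod.mk_sup_mk, Prod.mk_inf_mk, Prod.mk_add_mk] at he ⊢
    omega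

/-- The planar dual of the square lattice, with plaquettes labelled by their lower left corners, is
again the square lattice.  This maps an edge of the dual to the edge of the primal lattice which
it crosses. -/
def crossedEdge (e : squareLattice.edgeSet) : squareLattice.edgeSet :=
  ⟨crossedPair e.1, crossedPair_mem_edgeSet e.1 e.2⟩

/-- The dual configuration: a dual edge is open exactly if the primal edge it crosses is closed. -/
def dualConfig (ω : Config squareLattice) : Config squareLattice :=
  fun e => ! ω (crossedEdge e)

/-- The dual measure `μ*`: the law of the dual configuration, on the plaquettes of the lattice. -/
noncomputable def dualMeasure (μ : Measure (Config squareLattice)) :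
    Measure (Config squareLattice) :=
  μ.map dualConfig

theorem measurable_translate (v : ℤ × ℤ) : Measurable (translate v) :=
  measurable_pi_lambda _ fun _ => measurable_pi_apply _

theorem measurable_restrictHalfPlane : Measurable restrictHalfPlane :=
  measurable_pi_lambda _ fun _ => measurable_pi_apply _

theorem measurable_dualConfig : Measurable dualConfig :=
  measurable_pi_lambda _ fun _ => (measurable_from_top (f := not)).comp (measurable_pi_apply _)

end Percolation

namespace Percolation

/-! By invariance, almost surely every half-plane `H_n` above height `n` has one infinite cluster,
and these clusters are nested. If the cluster of `H_n` meets its bottom row, a path from the cluster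
of `H_{n+1}` down to that row must use a vertical edge leaving the latter cluster, a leg
(`exists_leg`); so the cluster of `H_{n+1}` meets its bottom row too. "The bottom row is met" is
thus increasing in `n`, has constant probability, and holds for some `n ≥ 0` because a cluster has a
lowest vertex; hence it is almost sure at every height (`ae_mem_of_measure_const`). The same lemma,
with horizontal shifts, puts legs arbitrarily far left and right.

An infinite dual cluster would have a lowest plaquette `(i, m)`, with infinite component in the dual
half-plane above `m`. Legs at height `m` on both sides of it are joined through the infinite cluster
of `H_{m+1}`, forming an open arc over it. Being under the arc is tested by the parity of arc edges
above a plaquette: odd at `(i, m)`, constant along open dual edges, and nonzero at only finitely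
many plaquettes. So the dual component is finite (`not_inInfinite_dual`). -/

/-- The subgraph formed by the edges with both endpoints at height at least `n`. -/
def above (G : SimpleGraph (ℤ × ℤ)) (n : ℤ) : SimpleGraph (ℤ × ℤ) where
  Adj u v := G.Adj u v ∧ n ≤ u.2 ∧ n ≤ v.2
  symm := ⟨fun _ _ h => ⟨h.1.symm, h.2.2, h.2.1⟩⟩
  loopless := ⟨fun _ h => G.irrefl h.1⟩

/-- The connected component of `v` in `G` is infinite. -/
def InInfinite {V : Type} (G : SimpleGraph V) (v : V) : Prop :=
  {w | G.Reachable v w}.Infinite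

/-- There is exactly one infinite connected component. -/
def UniqueInfinite {V : Type} (G : SimpleGraph V) : Prop :=
  (∃ v, InInfinite G v) ∧ ∀ v w, InInfinite G v → InInfinite G w → G.Reachable v w

/-- The vertical edge from `(x, n)` to `(x, n + 1)` is in `G`, and leads to an infinite connected
component of the half-plane above height `n + 1`. -/
def Leg (G : SimpleGraph (ℤ × ℤ)) (n x : ℤ) : Prop :=
  G.Adj (x, n) (x, n + 1) ∧ InInfinite (above G (n + 1)) (x, n + 1)

/-! ### Infinite components and their transport along bijections -/

section Graph

variable {V W : Type} {G : SimpleGraph V}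

theorem InInfinite.of_reachable {u v : V} (hu : InInfinite G u) (h : G.Reachable u v) :
    InInfinite G v :=
  Set.Infinite.mono (fun _ hw => h.symm.trans hw) hu

theorem InInfinite.mono {G' : SimpleGraph V} (hG : G ≤ G') {v : V} (hv : InInfinite G v) :
    InInfinite G' v :=
  Set.Infinite.mono (fun _ hw => SimpleGraph.Reachable.mono hG hw) hv

theorem invariant_of_reachable {P : V → Prop} (hP : ∀ u v, G.Adj u v → P u → P v) {u v : V}
    (h : G.Reachable u v) (hu : P u) : P v := by
  obtain ⟨p⟩ := h
  induction p with
  | nil => exact hu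
  | cons h _ ih => exact ih (hP _ _ h hu)

theorem inInfinite_comap_iff (e : W ≃ V) (w : W) :
    InInfinite (G.comap e) w ↔ InInfinite G (e w) := by
  have h : {x | (G.comap e).Reachable w x} = e ⁻¹' {x | G.Reachable (e w) x} := by
    ext x
    exact ((SimpleGraph.Iso.comap e G).reachable_iff (u := w) (v := x)).symm
  rw [InInfinite, InInfinite, h, ← e.image_symm_eq_preimage,
    Set.infinite_image_iff e.symm.injective.injOn]

theorem uniqueInfinite_comap_iff (e : W ≃ V) :
    UniqueInfinite (G.comap e) ↔ UniqueInfinite G := by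
  have h : ∀ x y, (G.comap e).Reachable x y ↔ G.Reachable (e x) (e y) := fun x y =>
    ((SimpleGraph.Iso.comap e G).reachable_iff (u := x) (v := y)).symm
  simp only [UniqueInfinite, inInfinite_comap_iff, h, e.surjective.exists, e.surjective.forall]

theorem inInfinite_iff {v : V} : InInfinite G v ↔ (G.connectedComponentMk v).supp.Infinite := by
  have h : (G.connectedComponentMk v).supp = {w | G.Reachable v w} := by
    ext w
    rw [SimpleGraph.ConnectedComponent.mem_supp_iff, SimpleGraph.ConnectedComponent.eq]
    exact ⟨SimpleGraph.Reachable.symm, SimpleGraph.Reachable.symm⟩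
  rw [h, InInfinite]

theorem exists_infinite_component_iff :
    (∃ C : G.ConnectedComponent, C.supp.Infinite) ↔ ∃ v, InInfinite G v := by
  simp only [inInfinite_iff]
  exact ⟨fun ⟨C, hC⟩ => by obtain ⟨v, rfl⟩ := C.exists_rep; exact ⟨v, hC⟩, fun ⟨v, hv⟩ => ⟨_, hv⟩⟩

theorem uniqueInfinite_of_existsUnique
    (h : ∃! C : G.ConnectedComponent, C.supp.Infinite) : UniqueInfinite G :=
  ⟨exists_infinite_component_iff.1 h.exists, fun _ _ hv hw =>
    SimpleGraph.ConnectedComponent.exact (h.unique (inInfinite_iff.1 hv) (inInfinite_iff.1 hw))⟩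

end Graph

/-! ### Infinite components in nested half-planes -/

section Above

variable {G : SimpleGraph (ℤ × ℤ)} {n : ℤ}

theorem above_anti (G : SimpleGraph (ℤ × ℤ)) : Antitone (above G) :=
  fun _ _ h _ _ hw => ⟨hw.1, h.trans hw.2.1, h.trans hw.2.2⟩

theorem le_of_reachable_above {u v : ℤ × ℤ} (h : (above G n).Reachable u v) (hu : n ≤ u.2) :
    n ≤ v.2 :=
  invariant_of_reachable (fun _ _ (h : (above G n).Adj _ _) _ => h.2.2) h hu

theorem InInfinite.le {v : ℤ × ℤ} (h : InInfinite (above G n) v) : n ≤ v.2 := by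
  by_contra hn
  refine h ((Set.finite_singleton v).subset fun w hw => ?_)
  exact invariant_of_reachable (P := fun x => x = v)
    (fun x y hxy hx => absurd (hx ▸ hxy.2.1) hn) hw rfl

theorem above_comap_sub (v : ℤ × ℤ) (n : ℤ) :
    above (G.comap (Equiv.subRight v)) n = (above G (n - v.2)).comap (Equiv.subRight v) := by
  ext a b
  simp [above]

/-- The lowest vertex of an infinite component lies in an infinite component above its height. -/
theorem InInfinite.exists_lowest {v : ℤ × ℤ} (h : InInfinite (above G n) v) :
    ∃ w : ℤ × ℤ, n ≤ w.2 ∧ InInfinite (above G w.2) w := by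
  have key : ∃ m : ℤ, (∃ w, (above G n).Reachable v w ∧ w.2 = m) ∧
      ∀ z, (∃ w, (above G n).Reachable v w ∧ w.2 = z) → m ≤ z :=
    Int.exists_least_of_bdd
      ⟨n, fun z ⟨w, hw, hz⟩ => hz ▸ le_of_reachable_above hw h.le⟩
      ⟨v.2, v, SimpleGraph.Reachable.refl _, rfl⟩
  obtain ⟨_, ⟨w, hw, rfl⟩, hmin⟩ := key
  refine ⟨w, le_of_reachable_above hw h.le, ?_⟩
  refine Set.Infinite.mono (fun x hx => ?_) (h.of_reachable hw)
  refine (invariant_of_reachable (G := above G n)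
    (P := fun x => (above G n).Reachable v x ∧ (above G w.2).Reachable w x) ?_ hx
    ⟨hw, SimpleGraph.Reachable.refl _⟩).2
  rintro a b hab ⟨ha, ha'⟩
  have hb := ha.trans hab.reachable
  exact ⟨hb, ha'.trans (SimpleGraph.Adj.reachable
    (show (above G w.2).Adj a b from ⟨hab.1, hmin _ ⟨a, ha, rfl⟩, hmin _ ⟨b, hb, rfl⟩⟩))⟩

theorem exists_leg (hG : G ≤ squareLattice) (hn : UniqueInfinite (above G n))
    (hn' : UniqueInfinite (above G (n + 1))) {x : ℤ}
    (hx : InInfinite (above G n) (x, n)) : ∃ y, Leg G n y := by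
  obtain ⟨w, hw⟩ := hn'.1
  have hle := above_anti G (show n ≤ n + 1 by omega)
  have hwx := hn.2 _ _ (hw.mono hle) hx
  by_contra hno
  -- Without legs no step of `above G n` leaves the component of `w` in `above G (n + 1)`, which
  -- then would contain `(x, n)`.
  have := invariant_of_reachable (P := fun u => (above G (n + 1)).Reachable w u) ?_ hwx
    (SimpleGraph.Reachable.refl _)
  · have h2 := le_of_reachable_above this hw.le
    simp at h2
  · rintro a b hab ha
    have h1 := le_of_reachable_above ha hw.le
    by_cases hb : n + 1 ≤ b.2
    · exact ha.trans (SimpleGraph.Adj.reachable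
        (show (above G (n + 1)).Adj a b from ⟨hab.1, h1, hb⟩))
    · exfalso
      apply hno
      have h3 := hab.2.2
      have h4 := (squareLattice_adj _ _).1 (hG hab.1)
      have hb' : b = (b.1, n) := Prod.ext rfl (by dsimp only; omega)
      have ha' : a = (b.1, n + 1) := Prod.ext (by dsimp only; omega) (by dsimp only; omega)
      refine ⟨b.1, ?_, ?_⟩
      · rw [← hb', ← ha']
        exact hab.1.symm
      · rw [← ha']
        exact hw.of_reachable ha

end Above

/-! ### Measurability of connection events -/

section Measurability

variable {Ω V : Type} [MeasurableSpace Ω] [Countable V] {Γ : Ω → SimpleGraph V}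

theorem measurableSet_reachable (hΓ : ∀ u v, MeasurableSet {ω | (Γ ω).Adj u v}) (u v : V) :
    MeasurableSet {ω | (Γ ω).Reachable u v} := by
  have step : ∀ (n : ℕ) (u : V), MeasurableSet {ω | ∃ p : (Γ ω).Walk u v, p.length = n} := by
    intro n
    induction n with
    | zero =>
      intro u
      have : {ω | ∃ p : (Γ ω).Walk u v, p.length = 0} = {_ω : Ω | u = v} := by
        ext ω
        exact SimpleGraph.Walk.exists_length_eq_zero_iff
      rw [this]
      exact MeasurableSet.const _
    | succ n ih =>
      intro u
      have : {ω | ∃ p : (Γ ω).Walk u v, p.length = n + 1} =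
          ⋃ w, {ω | (Γ ω).Adj u w} ∩ {ω | ∃ p : (Γ ω).Walk w v, p.length = n} := by
        ext ω
        simp only [Set.mem_ofPred_eq, Set.mem_iUnion, Set.mem_inter_iff]
        constructor
        · rintro ⟨p, hp⟩
          cases p with
          | nil => simp at hp
          | cons h q => exact ⟨_, h, q, by simpa using hp⟩
        · rintro ⟨w, h, p, hp⟩
          exact ⟨p.cons h, by rw [SimpleGraph.Walk.length_cons, hp]⟩
      rw [this]
      exact MeasurableSet.iUnion fun w => (hΓ u w).inter (ih w)
  have : {ω | (Γ ω).Reachable u v} = ⋃ n, {ω | ∃ p : (Γ ω).Walk u v, p.length = n} := by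
    ext ω
    simp only [Set.mem_ofPred_eq, Set.mem_iUnion]
    exact ⟨fun ⟨p⟩ => ⟨_, p, rfl⟩, fun ⟨_, p, _⟩ => ⟨p⟩⟩
  rw [this]
  exact MeasurableSet.iUnion fun n => step n u

/-- A component is infinite iff it escapes every finite set of vertices, and there are only
countably many of these. -/
theorem measurableSet_inInfinite (hΓ : ∀ u v, MeasurableSet {ω | (Γ ω).Adj u v}) (v : V) :
    MeasurableSet {ω | InInfinite (Γ ω) v} := by
  have : {ω | InInfinite (Γ ω) v} =
      ⋂ F : Finset V, ⋃ w : {w // w ∉ F}, {ω | (Γ ω).Reachable v w} := by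
    ext ω
    simp only [Set.mem_ofPred_eq, Set.mem_iInter, Set.mem_iUnion]
    constructor
    · intro h F
      obtain ⟨w, hw, hF⟩ := Set.Infinite.exists_notMem_finset h F
      exact ⟨⟨w, hF⟩, hw⟩
    · intro h hfin
      obtain ⟨⟨w, hw⟩, hr⟩ := h hfin.toFinset
      exact hw (hfin.mem_toFinset.2 hr)
  rw [this]
  exact MeasurableSet.iInter fun F => MeasurableSet.iUnion fun w => measurableSet_reachable hΓ v w

end Measurability

/-- An almost surely increasing sequence of events with constant probability and full union consists
of almost sure events. -/
theorem ae_mem_of_measure_const {Ω : Type} [MeasurableSpace Ω] {μ : Measure Ω}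
    [IsProbabilityMeasure μ] {s : ℕ → Set Ω} (hs : MeasurableSet (s 0))
    (hconst : ∀ n, μ (s n) = μ (s 0)) (hmono : ∀ᵐ ω ∂μ, ∀ n, ω ∈ s n → ω ∈ s (n + 1))
    (hex : ∀ᵐ ω ∂μ, ∃ n, ω ∈ s n) : ∀ᵐ ω ∂μ, ω ∈ s 0 := by
  -- The events increase only almost surely; their accumulated unions increase everywhere and differ
  -- from them by null sets.
  have hacc : ∀ n, μ (Set.accumulate s n) = μ (s 0) := fun n => by
    rw [← hconst n]
    refine measure_congr ?_
    filter_upwards [hmono] with ω hω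
    refine propext ⟨fun h => ?_, fun h => Set.mem_accumulate.2 ⟨n, le_rfl, h⟩⟩
    obtain ⟨k, hk, hks⟩ := Set.mem_accumulate.1 h
    exact Nat.le_induction hks (fun n _ h => hω n h) n hk
  have hlim := tendsto_measure_iUnion_accumulate (μ := μ) (f := s)
  simp only [hacc] at hlim
  have h1 : μ (⋃ n, s n) = 1 := by
    rw [← measure_univ (μ := μ)]
    refine measure_congr ?_
    filter_upwards [hex] with ω hω
    exact propext ⟨fun _ => trivial, fun _ => Set.mem_iUnion.2 hω⟩
  rw [h1] at hlim
  exact (mem_ae_iff_prob_eq_one hs).2 (tendsto_nhds_unique tendsto_const_nhds hlim)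

/-! ### Configurations as random graphs -/

section Config

theorem openGraph_adj {V : Type} {G : SimpleGraph V} (ω : Config G) (u v : V) :
    (openGraph ω).Adj u v ↔ ∃ h : G.Adj u v, ω ⟨s(u, v), h⟩ = true := by
  rw [openGraph, SimpleGraph.fromEdgeSet_adj]
  exact ⟨fun h => h.1, fun h => ⟨h, h.1.ne⟩⟩

theorem openGraph_le {V : Type} {G : SimpleGraph V} (ω : Config G) : openGraph ω ≤ G :=
  fun u v h => ((openGraph_adj ω u v).1 h).1

theorem measurableSet_openGraph_adj {V : Type} (G : SimpleGraph V) (u v : V) :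
    MeasurableSet {ω : Config G | (openGraph ω).Adj u v} := by
  simp only [openGraph_adj]
  by_cases h : G.Adj u v
  · simp only [h, exists_true_left]
    exact measurableSet_eq_fun (measurable_pi_apply _) measurable_const
  · simp [h]

theorem measurableSet_above_adj (n : ℤ) (u v : ℤ × ℤ) :
    MeasurableSet {ω : Config squareLattice | (above (openGraph ω) n).Adj u v} :=
  (measurableSet_openGraph_adj _ u v).inter (MeasurableSet.const (n ≤ u.2 ∧ n ≤ v.2))

theorem measurableSet_inInfinite_above (n : ℤ) (u : ℤ × ℤ) :
    MeasurableSet {ω : Config squareLattice | InInfinite (above (openGraph ω) n) u} :=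
  measurableSet_inInfinite (measurableSet_above_adj n) u

theorem measurableSet_leg (n x : ℤ) :
    MeasurableSet {ω : Config squareLattice | Leg (openGraph ω) n x} :=
  (measurableSet_openGraph_adj _ _ _).inter (measurableSet_inInfinite_above _ _)

theorem measurableSet_hasNoInfiniteCluster :
    MeasurableSet {ω : Config halfPlane | HasNoInfiniteCluster ω} := by
  simp only [HasNoInfiniteCluster, exists_infinite_component_iff, not_exists]
  rw [Set.ofPred_forall]
  exact MeasurableSet.iInter fun v =>
    (measurableSet_inInfinite (measurableSet_openGraph_adj halfPlane) v).compl

theorem openGraph_translate (v : ℤ × ℤ) (ω : Config squareLattice) :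
    openGraph (translate v ω) = (openGraph ω).comap (Equiv.subRight v) := by
  ext a b
  rw [SimpleGraph.comap_adj, openGraph_adj, openGraph_adj]
  have h : ∀ a, (translation v).symm a = a - v := fun a => by
    change -v + a = a - v
    abel
  have h1 : squareLattice.Adj (a - v) (b - v) ↔ squareLattice.Adj a b := by
    rw [← h, ← h]
    exact (translation v).symm.map_rel_iff'
  have h2 : ∀ hab : squareLattice.Adj a b, translate v ω ⟨s(a, b), hab⟩ =
      ω ⟨s(a - v, b - v), h1.2 hab⟩ := fun hab => by
    refine congrArg ω (Subtype.ext ?_)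
    change s((translation v).symm a, (translation v).symm b) = s(a - v, b - v)
    rw [h, h]
  exact ⟨fun ⟨hab, he⟩ => ⟨h1.2 hab, h2 hab ▸ he⟩,
    fun ⟨hab, he⟩ => ⟨h1.1 hab, (h2 (h1.1 hab)).trans he⟩⟩

theorem openGraph_restrictHalfPlane (ω : Config squareLattice) :
    openGraph (restrictHalfPlane ω) = (openGraph ω).comap Subtype.val := by
  ext a b
  rw [SimpleGraph.comap_adj, openGraph_adj, openGraph_adj]
  rfl

end Config

/-! ### Parity of an arc above a plaquette -/

section Arc

/-- The sum over the steps of a walk, modulo 2, of a weight on pairs of vertices. -/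
def walkSum {V : Type} {G : SimpleGraph V} (c : V → V → ZMod 2) {u v : V} : G.Walk u v → ZMod 2
  | .nil => 0
  | .cons (u := a) (v := b) _ p => c a b + walkSum c p

variable {V : Type} {G : SimpleGraph V} {u v : V}

theorem walkSum_congr {c d : V → V → ZMod 2} (h : ∀ a b, G.Adj a b → c a b = d a b)
    (p : G.Walk u v) : walkSum c p = walkSum d p := by
  induction p with
  | nil => rfl
  | cons hab p ih => rw [walkSum, walkSum, h _ _ hab, ih]

theorem walkSum_add (c d : V → V → ZMod 2) (p : G.Walk u v) :
    walkSum (fun a b => c a b + d a b) p = walkSum c p + walkSum d p := by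
  induction p with
  | nil => rfl
  | cons hab p ih => rw [walkSum, walkSum, walkSum, ih]; ring

theorem walkSum_coboundary (f : V → ZMod 2) (p : G.Walk u v) :
    walkSum (fun a b => f a + f b) p = f u + f v := by
  induction p with
  | nil => exact (CharTwo.add_self_eq_zero _).symm
  | @cons a b c hab p ih =>
    rw [walkSum, ih, add_assoc, ← add_assoc (f b), CharTwo.add_self_eq_zero, zero_add]

theorem exists_mem_support_of_walkSum_ne_zero {c : V → V → ZMod 2} (p : G.Walk u v)
    (h : walkSum c p ≠ 0) : ∃ a ∈ p.support, ∃ b, G.Adj a b ∧ c a b ≠ 0 := by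
  induction p with
  | nil => exact absurd rfl h
  | @cons a b d hab p ih =>
    by_cases hc : c a b = 0
    · rw [walkSum, hc, zero_add] at h
      obtain ⟨x, hx, hx'⟩ := ih h
      exact ⟨x, by simp [hx], hx'⟩
    · exact ⟨a, by simp, b, hab, hc⟩

/-- Whether the pair `a`, `b` spans a horizontal edge above the plaquette `p`. -/
def spans (p a b : ℤ × ℤ) : ZMod 2 :=
  if a.2 = b.2 ∧ p.2 < a.2 ∧ (a.1 = p.1 ∧ b.1 = p.1 + 1 ∨ b.1 = p.1 ∧ a.1 = p.1 + 1) then 1 else 0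

end Arc

/-- The dual adjacency: the plaquettes `p` and `q` share a side, which is not in `G`. -/
def DualAdj (G : SimpleGraph (ℤ × ℤ)) (p q : ℤ × ℤ) : Prop :=
  (q = (p.1 + 1, p.2) ∧ ¬ G.Adj (p.1 + 1, p.2) (p.1 + 1, p.2 + 1)) ∨
  (q = (p.1, p.2 + 1) ∧ ¬ G.Adj (p.1, p.2 + 1) (p.1 + 1, p.2 + 1))

variable {G : SimpleGraph (ℤ × ℤ)} {m : ℤ}

/-- The part of `above G m` obtained by deleting the horizontal edges at height `m`. -/
def aboveTrim (G : SimpleGraph (ℤ × ℤ)) (m : ℤ) : SimpleGraph (ℤ × ℤ) where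
  Adj u v := G.Adj u v ∧ m ≤ u.2 ∧ m ≤ v.2 ∧ (m < u.2 ∨ m < v.2)
  symm := ⟨fun _ _ h => ⟨h.1.symm, h.2.2.1, h.2.1, h.2.2.2.symm⟩⟩
  loopless := ⟨fun _ h => G.irrefl h.1⟩

theorem walkSum_over_dualAdj (hG : G ≤ squareLattice) {p q : ℤ × ℤ} (hpq : DualAdj G p q)
    (hp : m ≤ p.2) {x y : ℤ} (w : (aboveTrim G m).Walk (x, m) (y, m)) :
    walkSum (spans p) w = walkSum (spans q) w := by
  obtain ⟨i, j⟩ := p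
  rcases hpq with ⟨rfl, h⟩ | ⟨rfl, h⟩
  -- The two counts differ by the coboundary of the vertical ray above the shared side: the ray's
  -- only vertical boundary edge is that side, absent from `G`. Both ends of the walk, at height `m
  -- ≤ j`, are off the ray.
  · let f : ℤ × ℤ → ZMod 2 := fun z => if z.1 = i + 1 ∧ j < z.2 then 1 else 0
    have h1 : walkSum (fun a b => spans (i, j) a b + spans (i + 1, j) a b) w = 0 := by
      rw [walkSum_congr (d := fun a b => f a + f b), walkSum_coboundary]
      · have : ¬ j < m := not_lt.2 hp
        simp [f, this]
      · rintro ⟨a, a'⟩ ⟨b, b'⟩ ⟨hab, -⟩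
        have hl := (squareLattice_adj _ _).1 (hG hab)
        simp only [spans, f] at *
        have hne : ¬ (a = i + 1 ∧ a' = j ∧ b = i + 1 ∧ b' = j + 1) := by
          rintro ⟨rfl, rfl, rfl, rfl⟩; exact h hab
        have hne' : ¬ (b = i + 1 ∧ b' = j ∧ a = i + 1 ∧ a' = j + 1) := by
          rintro ⟨rfl, rfl, rfl, rfl⟩; exact h hab.symm
        split_ifs <;> first | rfl | (exfalso; omega)
    rw [walkSum_add] at h1
    exact CharTwo.add_eq_zero.1 h1
  -- Here the counts could differ only on the shared horizontal side, which is absent from `G`.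
  · refine walkSum_congr ?_ w
    rintro ⟨a, a'⟩ ⟨b, b'⟩ ⟨hab, -⟩
    have hne : ¬ (a = i ∧ a' = j + 1 ∧ b = i + 1 ∧ b' = j + 1) := by
      rintro ⟨rfl, rfl, rfl, rfl⟩; exact h hab
    have hne' : ¬ (b = i ∧ b' = j + 1 ∧ a = i + 1 ∧ a' = j + 1) := by
      rintro ⟨rfl, rfl, rfl, rfl⟩; exact h hab.symm
    simp only [spans]
    congr 1
    apply propext
    omega

/-- With no horizontal edges at height `m`, every crossing of column `i` is counted, so the parity
says whether the ends are separated by that column. -/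
theorem walkSum_over_bottom (hG : G ≤ squareLattice) {i x y : ℤ} (hx : x ≤ i) (hy : i < y)
    (w : (aboveTrim G m).Walk (x, m) (y, m)) : walkSum (spans (i, m)) w = 1 := by
  let f : ℤ × ℤ → ZMod 2 := fun z => if z.1 ≤ i then 1 else 0
  rw [walkSum_congr (d := fun a b => f a + f b), walkSum_coboundary]
  · simp [f, hx, hy]
  · rintro ⟨a, a'⟩ ⟨b, b'⟩ ⟨hab, h1, h2, h3⟩
    have hl := (squareLattice_adj _ _).1 (hG hab)
    simp only [spans, f] at *
    split_ifs <;> first | rfl | (exfalso; omega)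

theorem finite_walkSum_over_ne_zero {x y : ℤ × ℤ} (w : (aboveTrim G m).Walk x y) :
    {p : ℤ × ℤ | m ≤ p.2 ∧ walkSum (spans p) w ≠ 0}.Finite := by
  -- A counted edge has an endpoint `a` on the walk, so the plaquette lies in column `a.1 - 1` or
  -- `a.1` and below `a`.
  have hfin : (⋃ a ∈ w.support.toFinset, Set.Icc (a.1 - 1) a.1 ×ˢ Set.Icc m a.2).Finite :=
    Set.Finite.biUnion (Finset.finite_toSet _) fun a _ =>
      (Set.finite_Icc _ _).prod (Set.finite_Icc _ _)
  refine hfin.subset ?_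
  rintro ⟨i, j⟩ ⟨hj, hne⟩
  obtain ⟨a, ha, b, hab, hc⟩ := exists_mem_support_of_walkSum_ne_zero w hne
  simp only [spans, ne_eq, ite_eq_right_iff, not_forall] at hc
  obtain ⟨hc, -⟩ := hc
  simp only [Set.mem_iUnion]
  refine ⟨a, by simpa using ha, ?_⟩
  simp only [Set.mem_prod, Set.mem_Icc] at *
  omega

theorem exists_trimmed_walk (hu : UniqueInfinite (above G (m + 1))) {x y : ℤ}
    (hx : Leg G m x) (hy : Leg G m y) : (aboveTrim G m).Reachable (x, m) (y, m) := by
  have hleg : ∀ z, Leg G m z → (aboveTrim G m).Reachable (z, m) (z, m + 1) := fun z hz =>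
    SimpleGraph.Adj.reachable
      (show (aboveTrim G m).Adj _ _ from ⟨hz.1, le_rfl, by simp, by simp⟩)
  have hle : above G (m + 1) ≤ aboveTrim G m := fun a b h => by
    have := h.2
    exact ⟨h.1, by omega, by omega, by omega⟩
  exact (hleg x hx).trans (((hu.2 _ _ hx.2 hy.2).mono hle).trans (hleg y hy).symm)

/-- Arcs over the bottom row at every height trap the dual components. -/
theorem not_inInfinite_dual (hG : G ≤ squareLattice) {D : SimpleGraph (ℤ × ℤ)}
    (hD : ∀ p q, D.Adj p q → DualAdj G p q ∨ DualAdj G q p)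
    (hu : ∀ m, UniqueInfinite (above G m))
    (hleft : ∀ m k, ∃ x ≤ k, Leg G m x) (hright : ∀ m k, ∃ x, k ≤ x ∧ Leg G m x)
    (n : ℤ) (p : ℤ × ℤ) : ¬ InInfinite (above D n) p := by
  intro hp
  obtain ⟨⟨i, m⟩, -, hq⟩ := hp.exists_lowest
  obtain ⟨x, hx, hxl⟩ := hleft m i
  obtain ⟨y, hy, hyl⟩ := hright m (i + 1)
  obtain ⟨w⟩ := exists_trimmed_walk (hu (m + 1)) hxl hyl
  refine hq ((finite_walkSum_over_ne_zero w).subset fun z hz => ?_)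
  have h1 : walkSum (spans z) w = 1 :=
    invariant_of_reachable (G := above D m) (P := fun z => walkSum (spans z) w = 1)
      (fun a b hab ha => by
        rcases hD a b hab.1 with h | h
        · rw [← walkSum_over_dualAdj hG h hab.2.1 w]; exact ha
        · rw [walkSum_over_dualAdj hG h hab.2.2 w]; exact ha)
      hz (walkSum_over_bottom hG hx (by omega) w)
  exact ⟨le_of_reachable_above hz le_rfl, by rw [h1]; exact one_ne_zero⟩

/-! ### The induced half-plane versus `above G 0` -/

section HalfPlane

variable {G : SimpleGraph (ℤ × ℤ)}

theorem reachable_above_zero_iff (u v : {p : ℤ × ℤ // 0 ≤ p.2}) :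
    (above G 0).Reachable u v ↔
      (G.comap (Subtype.val : {p : ℤ × ℤ // 0 ≤ p.2} → ℤ × ℤ)).Reachable u v := by
  constructor
  · intro h
    obtain ⟨_, h⟩ := invariant_of_reachable (G := above G 0)
      (P := fun z => ∃ hz : 0 ≤ z.2, (G.comap Subtype.val).Reachable u ⟨z, hz⟩)
      (fun a b hab ⟨ha, h⟩ => ⟨hab.2.2, h.trans (SimpleGraph.Adj.reachable hab.1)⟩)
      h ⟨u.2, SimpleGraph.Reachable.refl _⟩
    exact h
  · exact fun h => invariant_of_reachable (P := fun z => (above G 0).Reachable u z.1)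
      (fun a b hab ha => ha.trans (SimpleGraph.Adj.reachable
        (show (above G 0).Adj a.1 b.1 from ⟨hab, a.2, b.2⟩))) h (SimpleGraph.Reachable.refl _)

theorem inInfinite_above_zero_iff (u : {p : ℤ × ℤ // 0 ≤ p.2}) :
    InInfinite (above G 0) u.1 ↔ InInfinite (G.comap Subtype.val) u := by
  have h : {w | (above G 0).Reachable u w} =
      Subtype.val '' {w | (G.comap Subtype.val).Reachable u w} := by
    ext w
    constructor
    · intro hw
      exact ⟨⟨w, le_of_reachable_above hw u.2⟩, (reachable_above_zero_iff _ _).1 hw, rfl⟩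
    · rintro ⟨w, hw, rfl⟩
      exact (reachable_above_zero_iff _ _).2 hw
  rw [InInfinite, InInfinite, h, Set.infinite_image_iff Subtype.val_injective.injOn]

theorem uniqueInfinite_above_zero
    (h : UniqueInfinite (G.comap (Subtype.val : {p : ℤ × ℤ // 0 ≤ p.2} → ℤ × ℤ))) :
    UniqueInfinite (above G 0) := by
  obtain ⟨⟨v, hv⟩, hu⟩ := h
  refine ⟨⟨v, (inInfinite_above_zero_iff v).2 hv⟩, fun a b ha hb => ?_⟩
  exact (reachable_above_zero_iff ⟨a, ha.le⟩ ⟨b, hb.le⟩).2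
    (hu _ _ ((inInfinite_above_zero_iff _).1 ha) ((inInfinite_above_zero_iff _).1 hb))

end HalfPlane

/-! ### Effect of translations -/

section Translate

variable (ω : Config squareLattice) (v : ℤ × ℤ) (n x : ℤ)

theorem above_translate : above (openGraph (translate v ω)) n =
    (above (openGraph ω) (n - v.2)).comap (Equiv.subRight v) := by
  rw [openGraph_translate, above_comap_sub]

theorem uniqueInfinite_above_translate_iff :
    UniqueInfinite (above (openGraph (translate v ω)) n) ↔
      UniqueInfinite (above (openGraph ω) (n - v.2)) := by
  rw [above_translate, uniqueInfinite_comap_iff]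

theorem inInfinite_above_translate_iff (u : ℤ × ℤ) :
    InInfinite (above (openGraph (translate v ω)) n) u ↔
      InInfinite (above (openGraph ω) (n - v.2)) (u - v) := by
  rw [above_translate, inInfinite_comap_iff]
  rfl

theorem leg_translate_iff :
    Leg (openGraph (translate v ω)) n x ↔ Leg (openGraph ω) (n - v.2) (x - v.1) := by
  rw [Leg, Leg, inInfinite_above_translate_iff, openGraph_translate, SimpleGraph.comap_adj]
  simp only [Equiv.subRight_apply]
  rw [show n + 1 - v.2 = n - v.2 + 1 by ring, show ((x, n) : ℤ × ℤ) - v = (x - v.1, n - v.2) from rfl,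
    show ((x, n + 1) : ℤ × ℤ) - v = (x - v.1, n + 1 - v.2) from rfl,
    show n + 1 - v.2 = n - v.2 + 1 by ring]

end Translate

/-! ### Almost sure consequences of invariance -/

section Stationary

variable {μ : Measure (Config squareLattice)}

theorem TranslationInvariant.ae_translate (hμ : TranslationInvariant μ)
    {P : Config squareLattice → Prop} (h : ∀ᵐ ω ∂μ, P ω) (v : ℤ × ℤ) :
    ∀ᵐ ω ∂μ, P (translate v ω) := by
  rw [← hμ v] at h
  exact ae_of_ae_map (measurable_translate v).aemeasurable h

theorem TranslationInvariant.measure_eq (hμ : TranslationInvariant μ)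
    {P Q : Config squareLattice → Prop} (hP : MeasurableSet {ω | P ω}) (v : ℤ × ℤ)
    (h : ∀ ω, P (translate v ω) ↔ Q ω) : μ {ω | Q ω} = μ {ω | P ω} := by
  conv_rhs => rw [← hμ v, Measure.map_apply (measurable_translate v) hP]
  congr 1
  ext ω
  exact (h ω).symm

theorem ae_forall_uniqueInfinite (hμ : TranslationInvariant μ)
    (h : ∀ᵐ ω ∂μ, UniqueInfinite (above (openGraph ω) 0)) :
    ∀ᵐ ω ∂μ, ∀ n, UniqueInfinite (above (openGraph ω) n) := by
  refine ae_all_iff.2 fun n => ?_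
  filter_upwards [hμ.ae_translate h (0, -n)] with ω hω
  simpa [uniqueInfinite_above_translate_iff] using hω

/-- Almost surely, infinitely connected vertices exist on every horizontal line. -/
theorem ae_exists_inInfinite_bottom [IsProbabilityMeasure μ] (hμ : TranslationInvariant μ)
    (h : ∀ᵐ ω ∂μ, ∀ n, UniqueInfinite (above (openGraph ω) n)) :
    ∀ᵐ ω ∂μ, ∀ n : ℤ, ∃ x, InInfinite (above (openGraph ω) n) (x, n) := by
  have hmeas : MeasurableSet {ω : Config squareLattice |
      ∃ x, InInfinite (above (openGraph ω) 0) (x, 0)} := by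
    rw [Set.ofPred_exists]
    exact MeasurableSet.iUnion fun x => measurableSet_inInfinite_above 0 (x, 0)
  have key : ∀ᵐ ω ∂μ, ∃ x, InInfinite (above (openGraph ω) 0) (x, 0) := by
    have := ae_mem_of_measure_const (μ := μ)
      (s := fun n : ℕ => {ω | ∃ x, InInfinite (above (openGraph ω) n) (x, (n : ℤ))})
      (by simpa using hmeas) (fun n => ?_) ?_ ?_
    · simpa using this
    · simp only [Nat.cast_zero]
      refine hμ.measure_eq hmeas (0, -(n : ℤ)) fun ω => ?_
      simp [inInfinite_above_translate_iff]
    · filter_upwards [h] with ω hω n ⟨x, hx⟩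
      obtain ⟨y, hy⟩ := exists_leg (openGraph_le ω) (hω n) (hω (n + 1)) hx
      exact ⟨y, by exact_mod_cast hy.2⟩
    · filter_upwards [h] with ω hω
      obtain ⟨v, hv⟩ := (hω 0).1
      obtain ⟨⟨x, m⟩, hm, hw⟩ := hv.exists_lowest
      lift m to ℕ using hm
      exact ⟨m, x, hw⟩
  refine ae_all_iff.2 fun n => ?_
  filter_upwards [hμ.ae_translate key (0, -n)] with ω hω
  simpa [inInfinite_above_translate_iff] using hω

/-- Almost surely, legs exist arbitrarily far to either side, as chosen by the sign `ε`. -/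
theorem ae_exists_leg_mem [IsProbabilityMeasure μ]
    (hμ : TranslationInvariant μ) (h : ∀ᵐ ω ∂μ, ∀ n, ∃ x, Leg (openGraph ω) n x)
    (ε : ℤˣ) : ∀ᵐ ω ∂μ, ∀ n k : ℤ, ∃ x, k ≤ ε * x ∧ Leg (openGraph ω) n x := by
  have hmeas : MeasurableSet {ω : Config squareLattice |
      ∃ x : ℤ, 0 ≤ ε * x ∧ Leg (openGraph ω) 0 x} := by
    rw [Set.ofPred_exists]
    exact MeasurableSet.iUnion fun x => (MeasurableSet.const _).inter (measurableSet_leg 0 x)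
  have hε : (ε : ℤ) * ε = 1 := Int.units_coe_mul_self ε
  -- Shifting by `-(ε * k)` moves the threshold `k` to `0`, as `ε * ε = 1`.
  have hshift : ∀ ω (n k : ℤ), (∃ x : ℤ, 0 ≤ ε * x ∧
      Leg (openGraph (translate (-(ε * k), -n) ω)) 0 x) ↔
        ∃ x : ℤ, k ≤ ε * x ∧ Leg (openGraph ω) n x := fun ω n k => by
    simp only [leg_translate_iff]
    constructor
    · rintro ⟨x, hx, hl⟩
      refine ⟨x + ε * k, ?_, by simpa using hl⟩
      rw [mul_add, ← mul_assoc, hε]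
      omega
    · rintro ⟨x, hx, hl⟩
      refine ⟨x - ε * k, ?_, by simpa using hl⟩
      rw [mul_sub, ← mul_assoc, hε]
      omega
  have key : ∀ᵐ ω ∂μ, ∃ x : ℤ, 0 ≤ ε * x ∧ Leg (openGraph ω) 0 x := by
    have := ae_mem_of_measure_const (μ := μ)
      (s := fun k : ℕ => {ω | ∃ x : ℤ, -(k : ℤ) ≤ ε * x ∧ Leg (openGraph ω) 0 x})
      (by simpa using hmeas) (fun k => ?_) ?_ ?_
    · simpa using this
    · simp only [Nat.cast_zero, neg_zero]
      exact hμ.measure_eq hmeas _ fun ω => hshift ω 0 (-k)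
    · refine Filter.Eventually.of_forall fun ω k => ?_
      rintro ⟨x, hx, hl⟩
      exact ⟨x, by push_cast; omega, hl⟩
    · filter_upwards [h] with ω hω
      obtain ⟨x, hx⟩ := hω 0
      exact ⟨((ε * x : ℤ)).natAbs, x, by omega, hx⟩
  refine ae_all_iff.2 fun n => ae_all_iff.2 fun k => ?_
  filter_upwards [hμ.ae_translate key (-(ε * k), -n)] with ω hω
  exact (hshift ω n k).1 hω

end Stationary

/-! ### Dual configurations and the conclusion -/

theorem dualAdj_of_openGraph_dualConfig (ω : Config squareLattice) {p q : ℤ × ℤ}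
    (h : (openGraph (dualConfig ω)).Adj p q) :
    DualAdj (openGraph ω) p q ∨ DualAdj (openGraph ω) q p := by
  have key : ∀ {p q : ℤ × ℤ}, (openGraph (dualConfig ω)).Adj p q →
      ¬ (openGraph ω).Adj (p ⊔ q) (p ⊓ q + (1, 1)) := by
    intro p q h h'
    obtain ⟨hpq, he⟩ := (openGraph_adj _ _ _).1 h
    obtain ⟨hpq', he'⟩ := (openGraph_adj _ _ _).1 h'
    have h2 : dualConfig ω ⟨s(p, q), hpq⟩ = ! ω ⟨s(p ⊔ q, p ⊓ q + (1, 1)), hpq'⟩ := rfl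
    rw [h2, he'] at he
    exact absurd he (by decide)
  have hl := (squareLattice_adj _ _).1 (openGraph_le _ h)
  have h1 := key h
  have h2 := key h.symm
  obtain ⟨a, b⟩ := p
  obtain ⟨c, d⟩ := q
  simp only at hl
  rcases hl with ⟨rfl, rfl⟩ | ⟨rfl, rfl⟩ | ⟨rfl, rfl⟩ | ⟨rfl, rfl⟩
  · exact Or.inl (Or.inl ⟨rfl, by simpa using h1⟩)
  · exact Or.inl (Or.inr ⟨rfl, by simpa using h1⟩)
  · exact Or.inr (Or.inl ⟨rfl, by simpa using h1⟩)
  · exact Or.inr (Or.inr ⟨rfl, by simpa using h1⟩)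

end Percolation

open Percolation

theorem proposition2p6
    (μ : MeasureTheory.Measure (Percolation.Config Percolation.squareLattice))
    [MeasureTheory.IsProbabilityMeasure μ]
    (hμ : Percolation.TranslationInvariant μ)
    (hunique : ∀ᵐ ω ∂(Percolation.halfPlaneMarginal μ), Percolation.HasUniqueInfiniteCluster ω) :
    ∀ᵐ ω ∂(Percolation.halfPlaneMarginal (Percolation.dualMeasure μ)),
      Percolation.HasNoInfiniteCluster ω := by
  -- Pulling the conclusion back to `μ` needs measurability of the event; pulling back the
  -- hypothesis does not.
  rw [halfPlaneMarginal, ae_map_iff measurable_restrictHalfPlane.aemeasurable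
    measurableSet_hasNoInfiniteCluster, dualMeasure, ae_map_iff measurable_dualConfig.aemeasurable
    (p := fun ω => HasNoInfiniteCluster (restrictHalfPlane ω))
    (measurable_restrictHalfPlane measurableSet_hasNoInfiniteCluster)]
  have h0 : ∀ᵐ ω ∂μ, UniqueInfinite (above (openGraph ω) 0) := by
    filter_upwards [ae_of_ae_map measurable_restrictHalfPlane.aemeasurable hunique] with ω hω
    have := uniqueInfinite_of_existsUnique hω
    rw [openGraph_restrictHalfPlane] at this
    exact uniqueInfinite_above_zero this
  have hu := ae_forall_uniqueInfinite hμ h0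
  have hleg : ∀ᵐ ω ∂μ, ∀ n, ∃ x, Leg (openGraph ω) n x := by
    filter_upwards [hu, ae_exists_inInfinite_bottom hμ hu] with ω hω hb n
    obtain ⟨x, hx⟩ := hb n
    exact exists_leg (openGraph_le ω) (hω n) (hω (n + 1)) hx
  filter_upwards [hu, ae_exists_leg_mem hμ hleg 1, ae_exists_leg_mem hμ hleg (-1)]
    with ω hω hright hleft
  rw [HasNoInfiniteCluster, exists_infinite_component_iff, openGraph_restrictHalfPlane]
  rintro ⟨v, hv⟩
  refine not_inInfinite_dual (openGraph_le ω)
    (fun _ _ => dualAdj_of_openGraph_dualConfig ω) hω (fun m k => ?_) (fun m k => ?_) 0 v.1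
    ((inInfinite_above_zero_iff v).2 hv)
  · obtain ⟨x, hx, hl⟩ := hleft m (-k)
    exact ⟨x, by simpa using hx, hl⟩
  · obtain ⟨x, hx, hl⟩ := hright m k
    exact ⟨x, by simpa using hx, hl⟩
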